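/- Let $\mathcal{F}$ be a small (elementary) topos and let $i:\mathcal{E}\hookrightarrow\mathcal{F}$ be a full subcategory that is a logical subtopos, i.e. is closed under a choice of finite limits, exponentials and a subobject classifier of $\mathcal{F}$. Assume that $\mathcal{E}$ is dense, i.e. (1) every object $X$ of $\mathcal{F}$ is a sheaf on $(\mathcal{F},\mathcal{E})$: for every $I\in\mathcal{F}$, the canonical map $\mathrm{Hom}_{\mathcal{F}}(I,X)\to\mathrm{Hom}_{\widehat{\mathcal{E}}}(\mathrm{Hom}_{\mathcal{F}}(i(-),I),\mathrm{Hom}_{\mathcal{F}}(i(-),X))$ is bijective; (2) the self-indexing $\mathcal{F}/(-)$ is a stack on $(\mathcal{F},\mathcal{E})$: for every $I\in\mathcal{F}$, the functor that sends $X\in\mathcal{F}/I$ to its canonical descent datum $(f:J\to I)\mapsto f^*X$ is an equivalence from $\mathcal{F}/I$ to the category of descent data at $I$. Here a descent datum at $I$ is a pseudonatural transformation from $\mathrm{Hom}_{\mathcal{F}}(i(-),I)$ to $J\mapsto\mathcal{F}/J$ over $\mathcal{E}^{\mathrm{op}}$: it assigns an object $\alpha_f\in\mathcal{F}/J$ to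 each $f:J\to I$ with $J\in\mathcal{E}$, and an isomorphism $\alpha_{f\circ g}\cong g^*\alpha_f$ to each $g:J'\to J$ in $\mathcal{E}$, coherently with identities and composition. Morphisms of descent data are modifications. A morphism $p:E\to B$ of $\mathcal{F}$ is called locally $\mathcal{E}$-small if for every $A\in\mathcal{E}$ and $f:A\to B$ there is a pullback of $p$ along $f$ whose vertex lies in $\mathcal{E}$. Assume that there is a generic locally $\mathcal{E}$-small map, i.e. a locally $\mathcal{E}$-small map $p$ such that every locally $\mathcal{E}$-small map is a pullback of $p$. Then the locally $\mathcal{E}$-small maps form an impredicative universe in $\mathcal{F}$ in the sense of Streicher. That is: (a) they form a class of display maps: they are closed under composition with isomorphisms, and the pullback of a locally $\mathcal{E}$-small map along any map of $\mathcal{F}$ exists and is locally $\mathcal{E}$-small; (b) the composite of two locally $\mathcal{E}$-small maps is locally $\mathcal{E}$-small; (c) there is a generic locally $\mathcal{E}$-small map; (d) the full subcategories $(\mathcal{F}/I)_{<\mathcal{E}}\subseteq\mathcal{F}/I$ on the locally $\mathcal{E}$-small maps with codomain $I$, for $I\in\mathcal{F}$, form an indexed logical subtopos of $\mathcal{F}/(-)$: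 each $\mathcal{F}/I$ is a topos and all reindexing functors $f^*:\mathcal{F}/J\to\mathcal{F}/I$ are logical (they preserve finite limits, exponentials and subobject classifiers); the subcategories are stable under reindexing; and each $(\mathcal{F}/I)_{<\mathcal{E}}$ is a logical subtopos of $\mathcal{F}/I$. -/

import Mathlib

universe v u v₁ u₁ v₂ u₂

open CategoryTheory CategoryTheory.Limits

namespace StreicherUniverse

/-! ### Toposes and logical functors -/

section Topos

variable {C : Type u₁} [Category.{v₁} C] {D : Type u₂} [Category.{v₂} D]

/-- `C` is an (elementary) topos: it has finite limits, is cartesian closed and has a subobject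
classifier. -/
class IsTopos (C : Type u₁) [Category.{v₁} C] : Prop
    extends HasFiniteLimits C, HasSubobjectClassifier C where
  cartesianClosed : ∃ _ : CartesianMonoidalCategory C, Nonempty (MonoidalClosed C)

/-- `X`, with the evaluation map `ev : R ⟶ B` defined on a product `R` of `X` and `A`
(with projections `fst`, `snd`), is an exponential `B ^ A`: for every product `S` of some object `Y`
with `A`, each `g : S ⟶ B` is `ev ∘ (h × A)` for exactly one `h : Y ⟶ X`. -/
structure IsExponential {A B X R : C} (fst : R ⟶ X) (snd : R ⟶ A) (ev : R ⟶ B) : Prop where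
  isProduct : Nonempty (IsLimit (BinaryFan.mk fst snd))
  existsUnique_curry : ∀ ⦃Y S : C⦄ (fst' : S ⟶ Y) (snd' : S ⟶ A),
    Nonempty (IsLimit (BinaryFan.mk fst' snd')) → ∀ g : S ⟶ B,
      ∃! h : Y ⟶ X, ∃ k : S ⟶ R, k ≫ fst = fst' ≫ h ∧ k ≫ snd = snd' ∧ k ≫ ev = g

/-- The morphism `t : T ⟶ Ω` is (the truth morphism of) a subobject classifier. -/
def IsSubobjectClassifier {T Ω : C} (t : T ⟶ Ω) : Prop :=
  ∃ c : Subobject.Classifier C, Nonempty (Arrow.mk c.truth ≅ Arrow.mk t)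

/-- A functor is logical if it preserves the topos structure: finite limits, exponentials and
subobject classifiers. -/
structure IsLogicalFunctor (G : C ⥤ D) : Prop where
  preservesFiniteLimits : PreservesFiniteLimits G
  map_isExponential : ∀ ⦃A B X R : C⦄ (fst : R ⟶ X) (snd : R ⟶ A) (ev : R ⟶ B),
    IsExponential fst snd ev → IsExponential (G.map fst) (G.map snd) (G.map ev)
  map_isSubobjectClassifier : ∀ ⦃T Ω : C⦄ (t : T ⟶ Ω),
    IsSubobjectClassifier t → IsSubobjectClassifier (G.map t)

/-- The full subcategory of the topos `C` on the objects satisfying `P` is a logical subtopos: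
it is closed under a choice of the topos structure of `C`. (`P` need not be closed under
isomorphism; hence the existential form of each condition.) -/
structure IsLogicalSubtopos (P : ObjectProperty C) : Prop where
  finiteLimits : ∀ (J : Type) [SmallCategory J] [FinCategory J] (K : J ⥤ C),
    (∀ j, P (K.obj j)) → ∃ c : Cone K, Nonempty (IsLimit c) ∧ P c.pt
  exponentials : ∀ A B : C, P A → P B →
    ∃ (X R : C) (fst : R ⟶ X) (snd : R ⟶ A) (ev : R ⟶ B), IsExponential fst snd ev ∧ P X
  subobjectClassifier : ∃ (T Ω : C) (t : T ⟶ Ω), IsSubobjectClassifier t ∧ P T ∧ P Ω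

end Topos

/-! ### Dense logical subtoposes -/

section Dense

variable {C : Type u} [Category.{v} C]

/-- The object `X` is a sheaf on `(C, P)`: for each object `I`, the canonical map
`Hom(I, X) → Hom(i^* (y I), i^* (y X))` is bijective, where `i` is the inclusion of the
full subcategory given by `P`. That is, the unit `y X ⟶ i_* i^* (y X)` is an isomorphism. -/
def IsSheafOn (P : ObjectProperty C) (X : C) : Prop :=
  ∀ I : C, Function.Bijective (fun e : I ⟶ X =>
    (Functor.whiskerLeft P.ι.op (yoneda.map e) :
      P.ι.op ⋙ yoneda.obj I ⟶ P.ι.op ⋙ yoneda.obj X))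

lemma comp_aux₁ {X₁ X₂ X₃ X₄ X₅ : C} {a : X₁ ⟶ X₂} {b : X₂ ⟶ X₃} {c : X₃ ⟶ X₄} {d : X₄ ⟶ X₅}
    {Y : C} {e : X₅ ⟶ Y} {k : X₂ ⟶ X₅} {m : X₁ ⟶ Y} (h₁ : b ≫ c ≫ d = k) (h₂ : a ≫ k ≫ e = m) :
    ((a ≫ b) ≫ c) ≫ d ≫ e = m := by
  rw [← h₂, ← h₁]
  simp only [Category.assoc]

lemma comp_aux₂ {X₁ X₂ X₃ X₄ X₅ : C} {a : X₁ ⟶ X₂} {b : X₂ ⟶ X₃} {c : X₃ ⟶ X₄} {d : X₄ ⟶ X₅}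
    {Y Z : C} {e : X₅ ⟶ Y} {k : X₂ ⟶ Z} {l : Z ⟶ X₄} {n : Z ⟶ Y} {m : X₁ ⟶ Y}
    (h₁ : b ≫ c = k ≫ l) (h₂ : l ≫ d ≫ e = n) (h₃ : a ≫ k ≫ n = m) :
    ((a ≫ b) ≫ c) ≫ d ≫ e = m := by
  rw [← h₃, ← h₂, Category.assoc a, h₁]
  simp only [Category.assoc]

section Pullback

variable [HasPullbacks C]

lemma pullbackId_hom_left {X : C} (A : Over X) :
    ((Over.pullbackId (X := X)).hom.app A).left = pullback.fst A.hom (𝟙 X) := by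
  simp [Over.pullbackId, conjugateIsoEquiv]

lemma pullbackId_inv_left_fst {X : C} (A : Over X) :
    ((Over.pullbackId (X := X)).inv.app A).left ≫ pullback.fst A.hom (𝟙 X) = 𝟙 A.left := by
  rw [← pullbackId_hom_left, ← Over.comp_left, Iso.inv_hom_id_app]
  rfl

lemma pullbackComp_hom_left_fst_fst {X Y Z : C} (f : X ⟶ Y) (g : Y ⟶ Z) (A : Over Z) :
    ((Over.pullbackComp f g).hom.app A).left ≫ pullback.fst (pullback.snd A.hom g) f ≫
      pullback.fst A.hom g = pullback.fst A.hom (f ≫ g) := by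
  have := congrArg CommaMorphism.left
    (conjugateEquiv_counit (Over.mapPullbackAdj (f ≫ g))
      ((Over.mapPullbackAdj f).comp (Over.mapPullbackAdj g)) (Over.mapComp f g).inv A)
  simpa [Over.pullbackComp, conjugateIsoEquiv] using this

/-- The comparison isomorphism `f'^* ≅ g^* ∘ f^*` of the self-indexing, for `f' = f ∘ g`. -/
noncomputable def reindexComp {J' J I : C} (g : J' ⟶ J) (f : J ⟶ I) (f' : J' ⟶ I)
    (h : g ≫ f = f') : Over.pullback f' ≅ Over.pullback f ⋙ Over.pullback g :=
  eqToIso (by subst h; rfl) ≪≫ Over.pullbackComp g f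

lemma reindexComp_hom_left_fst_fst {J' J I : C} (g : J' ⟶ J) (f : J ⟶ I) (f' : J' ⟶ I)
    (h : g ≫ f = f') (A : Over I) :
    ((reindexComp g f f' h).hom.app A).left ≫ pullback.fst (pullback.snd A.hom f) g ≫
      pullback.fst A.hom f = pullback.fst A.hom f' := by
  subst h
  simpa [reindexComp] using pullbackComp_hom_left_fst_fst g f A

lemma pullback_obj_hom_ext {J' J : C} {g : J' ⟶ J} {B : Over J} {A : Over J'}
    {φ ψ : A ⟶ (Over.pullback g).obj B}
    (h : φ.left ≫ pullback.fst B.hom g = ψ.left ≫ pullback.fst B.hom g) : φ = ψ := by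
  apply Over.OverMorphism.ext
  apply pullback.hom_ext h
  exact (Over.w φ).trans (Over.w ψ).symm

lemma pullback_map_left_fst {J' J : C} (g : J' ⟶ J) {A B : Over J} (φ : A ⟶ B) :
    ((Over.pullback g).map φ).left ≫ pullback.fst B.hom g =
      pullback.fst A.hom g ≫ φ.left :=
  pullback.lift_fst _ _ _

lemma left_fst_hom {J' J : C} {g : J' ⟶ J} {B : Over J} {A : Over J'}
    (φ : A ⟶ (Over.pullback g).obj B) :
    (φ.left ≫ pullback.fst B.hom g) ≫ B.hom = A.hom ≫ g := by
  rw [Category.assoc, pullback.condition, ← Category.assoc]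
  exact congrArg (· ≫ g) (Over.w φ)

lemma reindexComp_id {J I : C} (f : J ⟶ I) (X : Over I) :
    (reindexComp (𝟙 J) f f (Category.id_comp f)).hom.app X =
      Over.pullbackId.inv.app ((Over.pullback f).obj X) := by
  apply pullback_obj_hom_ext
  rw [pullbackId_inv_left_fst]
  apply pullback.hom_ext
  · rw [Category.assoc]
    exact (reindexComp_hom_left_fst_fst (𝟙 J) f f (Category.id_comp f) X).trans
      (Category.id_comp _).symm
  · have e := Over.w ((reindexComp (𝟙 J) f f (Category.id_comp f)).hom.app X)
    have e' : pullback.fst ((Over.pullback f).obj X).hom (𝟙 J) ≫ pullback.snd X.hom f =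
        ((Over.pullback f ⋙ Over.pullback (𝟙 J)).obj X).hom := by
      have := pullback.condition (f := ((Over.pullback f).obj X).hom) (g := 𝟙 J)
      rw [Category.comp_id] at this
      exact this
    rw [Category.assoc, e', e]
    exact (Category.id_comp _).symm

lemma reindexComp_comp {J'' J' J I : C} (g' : J'' ⟶ J') (g : J' ⟶ J) (f : J ⟶ I) (f' : J' ⟶ I)
    (f'' : J'' ⟶ I) (h : g ≫ f = f') (h' : g' ≫ f' = f'') (X : Over I) :
    (reindexComp (g' ≫ g) f f'' (by rw [Category.assoc, h, h'])).hom.app X ≫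
        (Over.pullbackComp g' g).hom.app ((Over.pullback f).obj X) =
      (reindexComp g' f' f'' h').hom.app X ≫
        (Over.pullback g').map ((reindexComp g f f' h).hom.app X) := by
  have e₁ := reindexComp_hom_left_fst_fst (g' ≫ g) f f'' (by rw [Category.assoc, h, h']) X
  have e₂ := pullbackComp_hom_left_fst_fst g' g ((Over.pullback f).obj X)
  have e₃ := reindexComp_hom_left_fst_fst g' f' f'' h' X
  have e₄ := reindexComp_hom_left_fst_fst g f f' h X
  have e₅ := pullback_map_left_fst g' ((reindexComp g f f' h).hom.app X)
  apply pullback_obj_hom_ext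
  generalize hφ : (reindexComp (g' ≫ g) f f'' _).hom.app X ≫
        (Over.pullbackComp g' g).hom.app ((Over.pullback f).obj X) = φ
  generalize hψ : (reindexComp g' f' f'' h').hom.app X ≫
        (Over.pullback g').map ((reindexComp g f f' h).hom.app X) = ψ
  have w := (left_fst_hom φ).trans (left_fst_hom ψ).symm
  have c : pullback.fst ((Over.pullback f).obj X).hom g ≫ pullback.snd X.hom f =
      ((Over.pullback g).obj ((Over.pullback f).obj X)).hom ≫ g := pullback.condition
  have hl : (φ.left ≫ pullback.fst ((Over.pullback g).obj ((Over.pullback f).obj X)).hom g') ≫ pullback.fst ((Over.pullback f).obj X).hom g ≫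
      pullback.fst X.hom f = pullback.fst X.hom f'' := by
    subst hφ
    exact comp_aux₁ e₂ e₁
  have hr : (ψ.left ≫ pullback.fst ((Over.pullback g).obj ((Over.pullback f).obj X)).hom g') ≫ pullback.fst ((Over.pullback f).obj X).hom g ≫
      pullback.fst X.hom f = pullback.fst X.hom f'' := by
    subst hψ
    exact comp_aux₂ e₅ e₄ e₃
  refine pullback.hom_ext (pullback.hom_ext ?_ ?_) w
  · simpa only [Category.assoc] using hl.trans hr.symm
  · have := congrArg (· ≫ g) w
    simp only [Category.assoc] at this ⊢
    erw [c]
    exact this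

/-- A descent datum at `I` for the self-indexing `C/(-)`, relative to the full subcategory given by
`P`: a pseudonatural transformation from `i^* (y I)` to `i^* (C/(-))`, where `i` is the inclusion.
It assigns to each `f : J ⟶ I` with `J` in the subcategory an object `obj f` of `C/J`, and to each
`g : J' ⟶ J` in the subcategory an isomorphism `obj (f ∘ g) ≅ g^* (obj f)`, coherently. -/
structure DescentDatum (P : ObjectProperty C) (I : C) where
  obj : ∀ {J : C}, P J → (J ⟶ I) → Over J
  iso : ∀ {J' J : C} (hJ' : P J') (hJ : P J) (g : J' ⟶ J) (f : J ⟶ I) (f' : J' ⟶ I),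
    g ≫ f = f' → (obj hJ' f' ≅ (Over.pullback g).obj (obj hJ f))
  iso_id : ∀ {J : C} (hJ : P J) (f : J ⟶ I),
    (iso hJ hJ (𝟙 J) f f (Category.id_comp f)).hom = Over.pullbackId.inv.app (obj hJ f)
  iso_comp : ∀ {J'' J' J : C} (hJ'' : P J'') (hJ' : P J') (hJ : P J) (g' : J'' ⟶ J') (g : J' ⟶ J)
    (f : J ⟶ I) (f' : J' ⟶ I) (f'' : J'' ⟶ I) (h : g ≫ f = f') (h' : g' ≫ f' = f''),
    (iso hJ'' hJ (g' ≫ g) f f'' (by rw [Category.assoc, h, h'])).hom ≫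
        (Over.pullbackComp g' g).hom.app (obj hJ f) =
      (iso hJ'' hJ' g' f' f'' h').hom ≫ (Over.pullback g').map (iso hJ' hJ g f f' h).hom

/-- A morphism of descent data: a modification between the pseudonatural transformations. -/
@[ext]
structure DescentDatum.Hom {P : ObjectProperty C} {I : C} (α β : DescentDatum P I) where
  app : ∀ {J : C} (hJ : P J) (f : J ⟶ I), α.obj hJ f ⟶ β.obj hJ f
  naturality : ∀ {J' J : C} (hJ' : P J') (hJ : P J) (g : J' ⟶ J) (f : J ⟶ I) (f' : J' ⟶ I)
    (h : g ≫ f = f'),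
    app hJ' f' ≫ (β.iso hJ' hJ g f f' h).hom =
      (α.iso hJ' hJ g f f' h).hom ≫ (Over.pullback g).map (app hJ f)

/-- The category `(i_* i^* (C/(-)))(I)` of descent data at `I`. -/
instance (P : ObjectProperty C) (I : C) : Category (DescentDatum P I) where
  Hom α β := DescentDatum.Hom α β
  id α :=
    { app := fun _ _ => 𝟙 _
      naturality := by intros; simp }
  comp φ ψ :=
    { app := fun hJ f => φ.app hJ f ≫ ψ.app hJ f
      naturality := by
        intro J' J hJ' hJ g f f' h
        rw [Category.assoc, ψ.naturality hJ' hJ g f f' h, ← Category.assoc,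
          φ.naturality hJ' hJ g f f' h, Category.assoc, ← Functor.map_comp] }
  id_comp φ := DescentDatum.Hom.ext (by funext; simp)
  comp_id φ := DescentDatum.Hom.ext (by funext; simp)
  assoc φ ψ χ := DescentDatum.Hom.ext (by funext; simp)

/-- The unit at `I` of the pseudoadjunction `i^* ⊣ i_*`, for the self-indexing `C/(-)`: it sends
`X` in `C/I` to its canonical descent datum, given by `f ↦ f^* X`. -/
noncomputable def toDescentDatum (P : ObjectProperty C) (I : C) : Over I ⥤ DescentDatum P I where
  obj X :=
    { obj := fun _ f => (Over.pullback f).obj X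
      iso := fun _ _ g f f' h => (reindexComp g f f' h).app X
      iso_id := fun _ f => reindexComp_id f X
      iso_comp := fun _ _ _ g' g f f' f'' h h' => reindexComp_comp g' g f f' f'' h h' X }
  map φ :=
    { app := fun _ f => (Over.pullback f).map φ
      naturality := by
        intro J' J hJ' hJ g f f' h
        exact (reindexComp g f f' h).hom.naturality φ }
  map_id X := DescentDatum.Hom.ext (by
    funext J hJ f
    exact (Over.pullback f).map_id X)
  map_comp φ ψ := DescentDatum.Hom.ext (by
    funext J hJ f
    exact (Over.pullback f).map_comp φ ψ)

/-- A logical subtopos of the topos `C` is dense if every object of `C` is a sheaf, and the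
self-indexing `C/(-)` is a stack, for the coverage given by the subtopos. -/
structure IsDenseLogicalSubtopos (P : ObjectProperty C) : Prop extends IsLogicalSubtopos P where
  isSheafOn : ∀ X : C, IsSheafOn P X
  isStack : ∀ I : C, (toDescentDatum P I).IsEquivalence

end Pullback

/-- The locally `P`-small maps: those whose pullback along any map from an object of the
subcategory can be formed inside the subcategory. -/
def locallySmall (P : ObjectProperty C) : MorphismProperty C :=
  fun E B p => ∀ ⦃A : C⦄ (f : A ⟶ B), P A →
    ∃ (D : C) (g : D ⟶ E) (q : D ⟶ A), IsPullback g q p f ∧ P D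

end Dense

/-! ### Impredicative universes -/

section Universe

variable {C : Type u} [Category.{v} C]

/-- A class of display maps: closed under composition with isomorphisms, and all pullbacks of
display maps exist and are display maps. -/
structure IsDisplayClass (W : MorphismProperty C) : Prop where
  respectsIso : W.RespectsIso
  exists_isPullback : ∀ ⦃E B A : C⦄ (p : E ⟶ B) (f : A ⟶ B), W p →
    ∃ (D : C) (g : D ⟶ E) (q : D ⟶ A), IsPullback g q p f ∧ W q

/-- The display map `p` is generic: every display map is a pullback of `p`. -/
structure IsGeneric (W : MorphismProperty C) {V U : C} (p : V ⟶ U) : Prop where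
  mem : W p
  exists_isPullback : ∀ ⦃A B : C⦄ (f : A ⟶ B), W f →
    ∃ (g : A ⟶ V) (h : B ⟶ U), IsPullback g f p h

/-- The full subcategory of `C/A` on the display maps with codomain `A`. -/
def displayOver (W : MorphismProperty C) (A : C) : ObjectProperty (Over A) :=
  fun X => W X.hom

/-- The full subcategories of the slices `C/A` given by `Q` form an indexed logical subtopos of the
self-indexing `C/(-)`: the self-indexing is an indexed topos (each `C/A` is a topos and the
reindexing functors are logical), the subcategories are stable under reindexing, and each of them is
a logical subtopos of the corresponding slice. -/
structure IsIndexedLogicalSubtopos [HasPullbacks C] (Q : ∀ A : C, ObjectProperty (Over A)) :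
    Prop where
  isTopos : ∀ A : C, IsTopos (Over A)
  isLogicalFunctor : ∀ ⦃A B : C⦄ (f : A ⟶ B), IsLogicalFunctor (Over.pullback f)
  reindex : ∀ ⦃A B : C⦄ (f : A ⟶ B) (X : Over B), Q B X → Q A ((Over.pullback f).obj X)
  isLogicalSubtopos : ∀ A : C, IsLogicalSubtopos (Q A)

/-- An impredicative universe: a class of display maps that is closed under composition, has a
generic display map, and whose indexed full subcategory of the self-indexing is an indexed logical
subtopos. -/
structure IsImpredicativeUniverse [HasPullbacks C] (W : MorphismProperty C) : Prop where
  isDisplayClass : IsDisplayClass W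
  comp_mem : ∀ ⦃X Y Z : C⦄ (f : X ⟶ Y) (g : Y ⟶ Z), W f → W g → W (f ≫ g)
  exists_generic : ∃ (V U : C) (p : V ⟶ U), IsGeneric W p
  isIndexedLogicalSubtopos : IsIndexedLogicalSubtopos (displayOver W)

end Universe

end StreicherUniverse

/-! Local smallness can be tested after pulling back to objects of `E`: `X` over `I` is locally
small iff, for every `f : A ⟶ I` with `A` in `E`, the total object of `f^* X` is isomorphic to one
in `E` (`displayOver_locallySmall_iff`). Stability under base change and composition is then pasting
of pullbacks, and the generic map is the given one. What remains is the topos structure on slices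
and its behaviour under `f^*`.

Two constructions carry this. Composition with `f` is a discrete fibration of slices, with right
adjoint `f^*`. Test objects over an image lift along a discrete fibration, so its right adjoint is
logical (`IsDiscreteFibration.isLogicalFunctor`). The same argument for `Over.forget A` makes
`Over.star A` logical, which yields the subobject classifiers of slices. Exponentials in a slice are
objects of functional graphs, built from power objects, binary products and equalizers alone
(`exists_isExponential_over`). Applied to all objects, this makes every slice a topos; applied to
`E.isoClosure`, it keeps exponentials inside `E`. Since `f^*` carries an exponential over `I` to one
over `A`, exponentials of locally small maps are locally small. -/

namespace StreicherUniverse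

attribute [local simp] prod.lift_fst prod.lift_snd prod.lift_fst_assoc prod.lift_snd_assoc
  pullback.lift_fst pullback.lift_snd pullback.lift_fst_assoc pullback.lift_snd_assoc
  equalizer.lift_ι equalizer.lift_ι_assoc

/-! ### Predicates on generalized elements -/

section Represented

variable {C : Type u₁} [Category.{v₁} C]

/-- A predicate on the generalized elements of `Z` is represented if it describes membership in a
subobject of `Z`. -/
def IsRepresented {Z : C} (φ : ∀ ⦃T : C⦄, (T ⟶ Z) → Prop) : Prop :=
  ∃ (D : C) (m : D ⟶ Z), Mono m ∧ ∀ ⦃T : C⦄ (z : T ⟶ Z), φ z ↔ ∃ k : T ⟶ D, k ≫ m = z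

lemma isRepresented_of_mono {D Z : C} (m : D ⟶ Z) [Mono m] :
    IsRepresented (fun T (z : T ⟶ Z) => ∃ k : T ⟶ D, k ≫ m = z) :=
  ⟨D, m, inferInstance, fun _ _ => Iff.rfl⟩

lemma IsRepresented.comp [HasPullbacks C] {Z Z' : C} {φ : ∀ ⦃T : C⦄, (T ⟶ Z) → Prop}
    (h : IsRepresented φ) (f : Z' ⟶ Z) :
    IsRepresented (fun T (z : T ⟶ Z') => φ (z ≫ f)) := by
  obtain ⟨D, m, _, hm⟩ := h
  refine ⟨pullback f m, pullback.fst f m, inferInstance, fun T z => (hm _).trans ⟨?_, ?_⟩⟩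
  · rintro ⟨k, hk⟩
    exact ⟨pullback.lift z k hk.symm, pullback.lift_fst _ _ _⟩
  · rintro ⟨k, rfl⟩
    exact ⟨k ≫ pullback.snd f m, by simp [pullback.condition]⟩

lemma IsRepresented.and [HasPullbacks C] {Z : C} {φ ψ : ∀ ⦃T : C⦄, (T ⟶ Z) → Prop}
    (h : IsRepresented φ) (h' : IsRepresented ψ) :
    IsRepresented (fun T (z : T ⟶ Z) => φ z ∧ ψ z) := by
  obtain ⟨D, m, _, hm⟩ := h
  obtain ⟨D', m', _, hm'⟩ := h'
  refine ⟨pullback m m', pullback.fst m m' ≫ m, inferInstance, fun T z => ?_⟩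
  refine (and_congr (hm _) (hm' _)).trans ⟨?_, ?_⟩
  · rintro ⟨⟨k, hk⟩, ⟨k', hk'⟩⟩
    exact ⟨pullback.lift k k' (hk.trans hk'.symm), by
      rw [pullback.lift_fst_assoc, hk]⟩
  · rintro ⟨k, rfl⟩
    exact ⟨⟨k ≫ pullback.fst m m', Category.assoc _ _ _⟩,
      ⟨k ≫ pullback.snd m m', by simp [pullback.condition]⟩⟩

lemma isRepresented_eq [HasEqualizers C] {Z W : C} (f g : Z ⟶ W) :
    IsRepresented (fun T (z : T ⟶ Z) => z ≫ f = z ≫ g) :=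
  ⟨equalizer f g, equalizer.ι f g, inferInstance, fun T z =>
    ⟨fun h => ⟨equalizer.lift z h, equalizer.lift_ι _ _⟩, by
      rintro ⟨k, rfl⟩
      rw [Category.assoc, equalizer.condition, Category.assoc]⟩⟩

end Represented

/-! ### Power objects -/

section PowerObject

variable {C : Type u₁} [Category.{v₁} C] [HasFiniteLimits C]

/-- `Q`, with the membership relation `mem`, is a power object of `Y`: generalized elements `T ⟶ Q`
correspond to subobjects of `T ⨯ Y`. -/
structure IsPowerObject (Y Q : C) (mem : ∀ ⦃T : C⦄, (T ⟶ Q) → (T ⟶ Y) → Prop) : Prop where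
  isRepresented : IsRepresented
    (fun T (z : T ⟶ Q ⨯ Y) => mem (z ≫ prod.fst) (z ≫ prod.snd))
  ext : ∀ ⦃T : C⦄ ⦃t t' : T ⟶ Q⦄,
    (∀ ⦃T' : C⦄ (s : T' ⟶ T) (y : T' ⟶ Y), mem (s ≫ t) y ↔ mem (s ≫ t') y) → t = t'
  comprehension : ∀ ⦃T : C⦄ (φ : ∀ ⦃T' : C⦄, (T' ⟶ T ⨯ Y) → Prop), IsRepresented φ →
    ∃ t : T ⟶ Q, ∀ ⦃T' : C⦄ (s : T' ⟶ T) (y : T' ⟶ Y), mem (s ≫ t) y ↔ φ (prod.lift s y)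

namespace IsPowerObject

variable {Y Q : C} {mem : ∀ ⦃T : C⦄, (T ⟶ Q) → (T ⟶ Y) → Prop}

lemma isRepresented_mem (h : IsPowerObject Y Q mem) {Z : C} (f : Z ⟶ Q) (g : Z ⟶ Y) :
    IsRepresented (fun T (z : T ⟶ Z) => mem (z ≫ f) (z ≫ g)) := by
  simpa using h.isRepresented.comp (prod.lift f g)

/-- The singleton map of a power object. -/
lemma exists_singleton (h : IsPowerObject Y Q mem) :
    ∃ σ : Y ⟶ Q, Mono σ ∧ ∀ ⦃T : C⦄ (y y' : T ⟶ Y), mem (y ≫ σ) y' ↔ y = y' := by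
  obtain ⟨σ, hσ⟩ := h.comprehension _ (isRepresented_eq (prod.fst (X := Y) (Y := Y)) prod.snd)
  simp only [prod.lift_fst, prod.lift_snd] at hσ
  exact ⟨σ, ⟨fun y y' e => ((hσ y' y).1 (e ▸ (hσ y y).2 rfl)).symm⟩, hσ⟩

end IsPowerObject

/-- Both maps are characteristic maps of the same subobject, the pullback of truth along `g`, so
uniqueness identifies them. -/
lemma classifier_hom_ext (c : Subobject.Classifier C) {Z : C} {f g : Z ⟶ c.Ω}
    (h : ∀ ⦃T : C⦄ (z : T ⟶ Z), z ≫ f = c.χ₀ T ≫ c.truth ↔ z ≫ g = c.χ₀ T ≫ c.truth) :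
    f = g := by
  have key : ∀ {f g : Z ⟶ c.Ω}, (∀ ⦃T : C⦄ (z : T ⟶ Z),
      z ≫ f = c.χ₀ T ≫ c.truth ↔ z ≫ g = c.χ₀ T ≫ c.truth) →
      f = c.χ (pullback.fst g c.truth) := by
    intro f g h
    have e : pullback.fst g c.truth ≫ f = c.χ₀ _ ≫ c.truth := by
      rw [h, pullback.condition, Subsingleton.elim (pullback.snd g c.truth)]
    refine c.uniq (χ₀' := c.χ₀ _) _ ⟨⟨e⟩, ⟨PullbackCone.IsLimit.mk _
      (fun s => pullback.lift s.fst s.snd ?_) (fun s => pullback.lift_fst _ _ _)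
      (fun s => Subsingleton.elim _ _) (fun s m hm _ => ?_)⟩⟩
    · have := (h s.fst).1 (s.condition.trans (by rw [Subsingleton.elim s.snd]))
      rw [this, Subsingleton.elim s.snd]
    · rw [← cancel_mono (pullback.fst g c.truth), hm, pullback.lift_fst]
  rw [key h, ← key (fun _ _ => Iff.rfl)]

/-- An exponential of the subobject classifier is a power object. -/
lemma IsExponential.exists_isPowerObject (c : Subobject.Classifier C) {Y Q R : C} {fst : R ⟶ Q}
    {snd : R ⟶ Y} {ev : R ⟶ c.Ω} (h : IsExponential fst snd ev) :
    ∃ mem, IsPowerObject Y Q mem := by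
  obtain ⟨⟨hR⟩, hc⟩ := h
  have lift_eq : ∀ ⦃T : C⦄ (t : T ⟶ Q) (y : T ⟶ Y), ∃ k : T ⟶ R, k ≫ fst = t ∧ k ≫ snd = y :=
    fun T t y => ⟨hR.lift (BinaryFan.mk t y), hR.fac _ ⟨.left⟩, hR.fac _ ⟨.right⟩⟩
  have hext : ∀ ⦃T : C⦄ (k k' : T ⟶ R), k ≫ fst = k' ≫ fst → k ≫ snd = k' ≫ snd → k = k' :=
    fun T k k' e e' => BinaryFan.IsLimit.hom_ext hR e e'
  -- `y` belongs to `t` when the pair `(t, y)`, read as an element of the product `R`, evaluates to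
  -- true.
  refine ⟨fun T t y => ∃ k : T ⟶ R, k ≫ fst = t ∧ k ≫ snd = y ∧ k ≫ ev = c.χ₀ T ≫ c.truth,
    ?_, ?_, ?_⟩
  · have hm : Mono (prod.lift fst snd) := ⟨fun k k' e => hext _ _
      (by simpa using e =≫ prod.fst) (by simpa using e =≫ prod.snd)⟩
    refine ⟨pullback ev c.truth, pullback.fst ev c.truth ≫ prod.lift fst snd, inferInstance,
      fun T z => ⟨?_, ?_⟩⟩
    · rintro ⟨k, h₁, h₂, h₃⟩
      exact ⟨pullback.lift k _ h₃, by apply prod.hom_ext <;> simp [h₁, h₂]⟩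
    · rintro ⟨k, rfl⟩
      refine ⟨k ≫ pullback.fst ev c.truth, by simp, by simp, ?_⟩
      rw [Category.assoc, pullback.condition, ← Category.assoc]
      congr 1
      exact Subsingleton.elim _ _
  · intro T t t' H
    obtain ⟨k, hk₁, hk₂⟩ := lift_eq (prod.fst (X := T) (Y := Y) ≫ t) prod.snd
    obtain ⟨k', hk₁', hk₂'⟩ := lift_eq (prod.fst (X := T) (Y := Y) ≫ t') prod.snd
    have e : k ≫ ev = k' ≫ ev := by
      refine classifier_hom_ext c fun T' z => ?_
      have := H (z ≫ prod.fst) (z ≫ prod.snd)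
      have a : ∀ (t : T ⟶ Q) (k : T ⨯ Y ⟶ R), k ≫ fst = prod.fst ≫ t → k ≫ snd = prod.snd →
          ((∃ l : T' ⟶ R, l ≫ fst = (z ≫ prod.fst) ≫ t ∧ l ≫ snd = z ≫ prod.snd ∧
            l ≫ ev = c.χ₀ T' ≫ c.truth) ↔ z ≫ k ≫ ev = c.χ₀ T' ≫ c.truth) := by
        intro t k h₁ h₂
        constructor
        · rintro ⟨l, l₁, l₂, l₃⟩
          rw [← l₃, ← Category.assoc]
          congr 1
          exact hext _ _ (by simp [l₁, h₁]) (by simp [l₂, h₂])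
        · intro h₃
          exact ⟨z ≫ k, by simp [h₁], by simp [h₂], by simpa using h₃⟩
      rw [← a t k hk₁ hk₂, ← a t' k' hk₁' hk₂']
      exact this
    obtain ⟨_, -, hu⟩ := hc prod.fst prod.snd ⟨prodIsProd T Y⟩ (k ≫ ev)
    exact (hu t ⟨k, hk₁, hk₂, rfl⟩).trans (hu t' ⟨k', hk₁', hk₂', e.symm⟩).symm
  · rintro T φ ⟨D, m, _, hm⟩
    obtain ⟨t, ⟨k, hk₁, hk₂, hk₃⟩, -⟩ := hc prod.fst prod.snd ⟨prodIsProd T Y⟩ (c.χ m)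
    refine ⟨t, fun T' s y => ?_⟩
    rw [hm]
    constructor
    · rintro ⟨l, l₁, l₂, l₃⟩
      have : prod.lift s y ≫ k = l := hext _ _ (by simp [hk₁, l₁]) (by simp [hk₂, l₂])
      exact ⟨(c.isPullback m).lift (prod.lift s y) (c.χ₀ _) (by rw [← hk₃, ← l₃, ← this]; simp),
        IsPullback.lift_fst _ _ _ _⟩
    · rintro ⟨l, hl⟩
      refine ⟨prod.lift s y ≫ k, by simp [hk₁], by simp [hk₂], ?_⟩
      rw [Category.assoc, hk₃, ← hl, Category.assoc, (c.isPullback m).w, ← Category.assoc]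
      congr 1
      exact Subsingleton.elim _ _

end PowerObject

/-! ### Binary products in slice categories -/

section OverProducts

variable {C : Type u₁} [Category.{v₁} C] {A : C} {T X S : Over A} {f : S ⟶ T} {s : S ⟶ X}

/-- A map from `W` to `T.left` makes `W` an object over `A`, so a product in the slice is a fibre
product for arbitrary test objects of `C`. -/
lemma exists_lift_of_isLimit_over (h : IsLimit (BinaryFan.mk f s)) {W : C} (t : W ⟶ T.left)
    (x : W ⟶ X.left) (e : t ≫ T.hom = x ≫ X.hom) :
    ∃ k : W ⟶ S.left, k ≫ f.left = t ∧ k ≫ s.left = x := by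
  let l := h.lift (BinaryFan.mk (P := Over.mk (t ≫ T.hom)) (Over.homMk t) (Over.homMk x e.symm))
  exact ⟨l.left, congrArg CommaMorphism.left (h.fac _ ⟨.left⟩),
    congrArg CommaMorphism.left (h.fac _ ⟨.right⟩)⟩

lemma hom_ext_of_isLimit_over (h : IsLimit (BinaryFan.mk f s)) {W : C} {k k' : W ⟶ S.left}
    (e : k ≫ f.left = k' ≫ f.left) (e' : k ≫ s.left = k' ≫ s.left) : k = k' := by
  have w : k' ≫ S.hom = k ≫ S.hom := by
    rw [← Over.w f, reassoc_of% e]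
  have := BinaryFan.IsLimit.hom_ext h (W := Over.mk (k ≫ S.hom)) (f := Over.homMk k)
    (g := Over.homMk k' w) (Over.OverMorphism.ext e) (Over.OverMorphism.ext e')
  exact congrArg CommaMorphism.left this

lemma isLimit_over_of_isPullback (h : IsPullback f.left s.left T.hom X.hom) :
    Nonempty (IsLimit (BinaryFan.mk f s)) := by
  refine ⟨BinaryFan.isLimitMk (fun c => Over.homMk (h.lift c.fst.left c.snd.left ?_) ?_)
    (fun c => ?_) (fun c => ?_) (fun c m hm hm' => ?_)⟩
  · exact (Over.w c.fst).trans (Over.w c.snd).symm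
  · rw [← Over.w f]
    exact (h.lift_fst_assoc _ _ _ _).trans (Over.w c.fst)
  · exact Over.OverMorphism.ext (h.lift_fst _ _ _)
  · exact Over.OverMorphism.ext (h.lift_snd _ _ _)
  · apply Over.OverMorphism.ext
    apply h.hom_ext
    · exact (congrArg CommaMorphism.left hm).trans (h.lift_fst _ _ _).symm
    · exact (congrArg CommaMorphism.left hm').trans (h.lift_snd _ _ _).symm

end OverProducts

/-! ### Exponentials in slice categories -/

section OverExponential

variable {C : Type u₁} [Category.{v₁} C] [HasFiniteLimits C]

/-- The element `G` of the power object of `X ⨯ Y` is the graph of a map over `A` from the fibre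
of `p : X ⟶ A` over `a` to the fibre of `q : Y ⟶ A` over `a`. -/
structure IsFunctionalGraph {A X Y Q : C} (p : X ⟶ A) (q : Y ⟶ A)
    (mem : ∀ ⦃T : C⦄, (T ⟶ Q) → (T ⟶ X ⨯ Y) → Prop) {T : C} (a : T ⟶ A) (G : T ⟶ Q) : Prop where
  -- The right-hand side expresses, stably under restriction, that the slice of `G` at `x` is the
  -- singleton of `y`.
  total : ∀ ⦃T' : C⦄ (t : T' ⟶ T) (x : T' ⟶ X), t ≫ a = x ≫ p ↔
    ∃ y : T' ⟶ Y, ∀ ⦃T'' : C⦄ (t' : T'' ⟶ T') (y' : T'' ⟶ Y),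
      mem (t' ≫ t ≫ G) (prod.lift (t' ≫ x) y') ↔ t' ≫ y = y'
  hom_eq : ∀ ⦃T' : C⦄ (t : T' ⟶ T) (w : T' ⟶ X ⨯ Y), mem (t ≫ G) w →
    w ≫ prod.fst ≫ p = t ≫ a ∧ w ≫ prod.snd ≫ q = t ≫ a

/-- The object of functional graphs is an equalizer of maps between products of power objects. -/
lemma exists_classifier_isFunctionalGraph (P : ObjectProperty C)
    [P.IsClosedUnderBinaryProducts] [P.IsClosedUnderLimitsOfShape WalkingParallelPair]
    {A X Y Q Q₁ Q₂ : C} (p : X ⟶ A) (q : Y ⟶ A)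
    {mem : ∀ ⦃T : C⦄, (T ⟶ Q) → (T ⟶ X ⨯ Y) → Prop} (hQ : IsPowerObject (X ⨯ Y) Q mem)
    {mem₁ : ∀ ⦃T : C⦄, (T ⟶ Q₁) → (T ⟶ X) → Prop} (hQ₁ : IsPowerObject X Q₁ mem₁)
    {mem₂ : ∀ ⦃T : C⦄, (T ⟶ Q₂) → (T ⟶ Y) → Prop} (hQ₂ : IsPowerObject Y Q₂ mem₂)
    (pA : P A) (pQ : P Q) (pQ₁ : P Q₁) :
    ∃ (Z : C) (a : Z ⟶ A) (G : Z ⟶ Q), P Z ∧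
      (∀ ⦃T : C⦄ (z z' : T ⟶ Z), z ≫ a = z' ≫ a → z ≫ G = z' ≫ G → z = z') ∧
      IsFunctionalGraph p q mem a G ∧
      ∀ ⦃T : C⦄ (a' : T ⟶ A) (G' : T ⟶ Q), IsFunctionalGraph p q mem a' G' →
        ∃ z : T ⟶ Z, z ≫ a = a' ∧ z ≫ G = G' := by
  -- In set notation: `sl (G, x) = {y | (x, y) ∈ G}`, `σ y = {y}`, `sg G = {x | sl (G, x) is a
  -- singleton}`, `pre a` is the fibre of `p` over `a`, and `int (G, a)` consists of the pairs in
  -- `G` with both components over `a`. The object `Q₂` only serves to define `sg`, so it need not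
  -- satisfy `P`.
  obtain ⟨sl, hsl⟩ := hQ₂.comprehension (T := Q ⨯ X) _
    (hQ.isRepresented_mem (prod.fst ≫ prod.fst) (prod.lift (prod.fst ≫ prod.snd) prod.snd))
  obtain ⟨σ, _, hσ⟩ := hQ₂.exists_singleton
  obtain ⟨sg, hsg⟩ := hQ₁.comprehension (T := Q) _ ((isRepresented_of_mono σ).comp sl)
  obtain ⟨pre, hpre⟩ := hQ₁.comprehension (T := A) _
    (isRepresented_eq prod.fst (prod.snd ≫ p))
  obtain ⟨int, hint⟩ := hQ.comprehension (T := Q ⨯ A) _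
    ((hQ.isRepresented_mem (prod.fst ≫ prod.fst) prod.snd).and
      ((isRepresented_eq (prod.snd ≫ prod.fst ≫ p) (prod.fst ≫ prod.snd)).and
        (isRepresented_eq (prod.snd ≫ prod.snd ≫ q) (prod.fst ≫ prod.snd))))
  simp only [prod.lift_fst, prod.lift_snd, prod.lift_fst_assoc, prod.lift_snd_assoc,
    prod.comp_lift] at hsl hsg hpre hint
  have hgraph : ∀ ⦃T : C⦄ (G : T ⟶ Q) (x : T ⟶ X) (y : T ⟶ Y),
      y ≫ σ = prod.lift G x ≫ sl ↔ ∀ ⦃T' : C⦄ (t : T' ⟶ T) (y' : T' ⟶ Y),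
        mem (t ≫ G) (prod.lift (t ≫ x) y') ↔ t ≫ y = y' := by
    intro T G x y
    have key : ∀ ⦃T' : C⦄ (t : T' ⟶ T) (y' : T' ⟶ Y),
        (mem₂ (t ≫ y ≫ σ) y' ↔ t ≫ y = y') ∧
        (mem₂ (t ≫ prod.lift G x ≫ sl) y' ↔ mem (t ≫ G) (prod.lift (t ≫ x) y')) := by
      intro T' t y'
      have h₁ := hσ (t ≫ y) y'
      have h₂ := hsl (t ≫ prod.lift G x) y'
      simp only [Category.assoc, prod.lift_fst, prod.lift_snd] at h₁ h₂
      exact ⟨h₁, h₂⟩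
    constructor
    · intro e T' t y'
      rw [← (key t y').1, e, (key t y').2]
    · intro H
      exact hQ₂.ext fun T' t y' => by rw [(key t y').1, (key t y').2, H]
  have hfun : ∀ ⦃T : C⦄ (a : T ⟶ A) (G : T ⟶ Q), IsFunctionalGraph p q mem a G ↔
      G ≫ sg = a ≫ pre ∧ G = prod.lift G a ≫ int := by
    intro T a G
    have key₁ : ∀ ⦃T' : C⦄ (t : T' ⟶ T) (x : T' ⟶ X), (mem₁ (t ≫ G ≫ sg) x ↔
        ∃ y : T' ⟶ Y, ∀ ⦃T'' : C⦄ (t' : T'' ⟶ T') (y' : T'' ⟶ Y),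
          mem (t' ≫ t ≫ G) (prod.lift (t' ≫ x) y') ↔ t' ≫ y = y') ∧
        (mem₁ (t ≫ a ≫ pre) x ↔ t ≫ a = x ≫ p) := by
      intro T' t x
      have h₁ := hsg (t ≫ G) x
      have h₂ := hpre (t ≫ a) x
      simp only [hgraph, Category.assoc] at h₁ h₂
      exact ⟨h₁, h₂⟩
    have key₂ : ∀ ⦃T' : C⦄ (t : T' ⟶ T) (w : T' ⟶ X ⨯ Y), mem (t ≫ prod.lift G a ≫ int) w ↔
        mem (t ≫ G) w ∧ w ≫ prod.fst ≫ p = t ≫ a ∧ w ≫ prod.snd ≫ q = t ≫ a := by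
      intro T' t w
      simpa only [Category.assoc, prod.lift_fst, prod.lift_snd] using
        hint (t ≫ prod.lift G a) w
    constructor
    · intro h
      refine ⟨hQ₁.ext fun T' t x => ?_, hQ.ext fun T' t w => ?_⟩
      · rw [(key₁ t x).1, (key₁ t x).2, h.total]
      · rw [key₂]
        exact ⟨fun hm => ⟨hm, h.hom_eq t w hm⟩, And.left⟩
    · rintro ⟨h₁, h₂⟩
      refine ⟨fun T' t x => ?_, fun T' t w hm => ?_⟩
      · rw [← (key₁ t x).1, ← (key₁ t x).2, h₁]
      · rw [h₂, key₂] at hm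
        exact hm.2
  -- The equations `sg G = pre a` and `G = int (G, a)` are combined into one, so that a single
  -- equalizer cuts out the functional graphs.
  let f : Q ⨯ A ⟶ Q₁ ⨯ Q := prod.lift (prod.fst ≫ sg) prod.fst
  let g : Q ⨯ A ⟶ Q₁ ⨯ Q := prod.lift (prod.snd ≫ pre) int
  have hfg : ∀ ⦃T : C⦄ (z : T ⟶ Q ⨯ A), z ≫ f = z ≫ g ↔
      IsFunctionalGraph p q mem (z ≫ prod.snd) (z ≫ prod.fst) := by
    intro T z
    have hz : prod.lift (z ≫ prod.fst) (z ≫ prod.snd) = z := by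
      apply prod.hom_ext <;> simp
    rw [hfun, hz]
    constructor
    · intro e
      exact ⟨by simpa [f, g] using e =≫ prod.fst, by simpa [f, g] using e =≫ prod.snd⟩
    · rintro ⟨e, e'⟩
      apply prod.hom_ext
      · simpa [f, g] using e
      · simpa [f, g] using e'
  refine ⟨equalizer f g, equalizer.ι f g ≫ prod.snd, equalizer.ι f g ≫ prod.fst, ?_, ?_, ?_, ?_⟩
  · apply P.prop_limit
    rintro (_ | _)
    · exact P.prop_prod _ _ pQ pA
    · exact P.prop_prod _ _ pQ₁ pQ
  · intro T z z' h₁ h₂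
    apply equalizer.hom_ext
    apply prod.hom_ext
    · simpa using h₂
    · simpa using h₁
  · exact (hfg _).1 (equalizer.condition f g)
  · intro T a' G' h
    refine ⟨equalizer.lift (prod.lift G' a') ((hfg _).2 (by simpa using h)), ?_, ?_⟩
    · rw [equalizer.lift_ι_assoc, prod.lift_snd]
    · rw [equalizer.lift_ι_assoc, prod.lift_fst]

/-- Slice categories have exponentials, which can be formed inside any class of objects that is
closed under finite limits and power objects. -/
theorem exists_isExponential_over (P : ObjectProperty C)
    [P.IsClosedUnderBinaryProducts] [P.IsClosedUnderLimitsOfShape WalkingParallelPair]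
    (hP : ∀ Y, P Y → ∃ Q mem, IsPowerObject Y Q mem ∧ P Q) {A : C} (X Y : Over A)
    (pA : P A) (pX : P X.left) (pY : P Y.left) :
    ∃ (Z R : Over A) (fst : R ⟶ Z) (snd : R ⟶ X) (ev : R ⟶ Y),
      IsExponential fst snd ev ∧ P Z.left := by
  obtain ⟨Q, mem, hQ, pQ⟩ := hP _ (P.prop_prod _ _ pX pY)
  obtain ⟨Q₁, mem₁, hQ₁, pQ₁⟩ := hP _ pX
  obtain ⟨Q₂, mem₂, hQ₂, -⟩ := hP _ pY
  obtain ⟨Z, a, G, pZ, hext, hG, huniv⟩ :=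
    exists_classifier_isFunctionalGraph P X.hom Y.hom hQ hQ₁ hQ₂ pA pQ pQ₁
  -- Evaluation is the value of the generic graph at the generic point of the fibre.
  obtain ⟨ev, hev⟩ := (hG.total (pullback.fst a X.hom) (pullback.snd a X.hom)).1
    pullback.condition
  have hev' : ev ≫ Y.hom = pullback.fst a X.hom ≫ a := by
    have := (hev (𝟙 _) ev).2 (Category.id_comp _)
    rw [Category.id_comp] at this
    simpa using (hG.hom_eq _ _ this).2
  refine ⟨Over.mk a, Over.mk (pullback.fst a X.hom ≫ a), Over.homMk (pullback.fst a X.hom),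
    Over.homMk (pullback.snd a X.hom) pullback.condition.symm, Over.homMk ev hev', ⟨?_, ?_⟩, pZ⟩
  · exact isLimit_over_of_isPullback (IsPullback.of_hasPullback a X.hom)
  intro T S f s ⟨hS⟩ g
  -- The source `S` is the fibre product of `T` and `X`, so it embeds in `T ⨯ (X ⨯ Y)` as the graph
  -- of `g`; comprehension names this subobject by `G'`.
  have hd : Mono (prod.lift f.left (prod.lift s.left g.left)) := ⟨fun k k' e =>
    hom_ext_of_isLimit_over hS (by simpa using e =≫ prod.fst)
      (by simpa using (e =≫ prod.snd) =≫ prod.fst)⟩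
  obtain ⟨G', hG'⟩ := hQ.comprehension (T := T.left) _
    (isRepresented_of_mono (prod.lift f.left (prod.lift s.left g.left)))
  replace hG' : ∀ ⦃T' : C⦄ (t : T' ⟶ T.left) (w : T' ⟶ X.left ⨯ Y.left), mem (t ≫ G') w ↔
      ∃ k : T' ⟶ S.left, k ≫ f.left = t ∧ k ≫ s.left = w ≫ prod.fst ∧
        k ≫ g.left = w ≫ prod.snd := by
    intro T' t w
    rw [hG']
    constructor
    · rintro ⟨k, e⟩
      exact ⟨k, by simpa using e =≫ prod.fst, by simpa using (e =≫ prod.snd) =≫ prod.fst,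
        by simpa using (e =≫ prod.snd) =≫ prod.snd⟩
    · rintro ⟨k, e₁, e₂, e₃⟩
      refine ⟨k, ?_⟩
      apply prod.hom_ext
      · simpa using e₁
      · apply prod.hom_ext
        · simpa using e₂
        · simpa using e₃
  have hfun : IsFunctionalGraph X.hom Y.hom mem T.hom G' := by
    refine ⟨fun T' t x => ⟨fun e => ?_, ?_⟩, fun T' t w hm => ?_⟩
    · obtain ⟨k, rfl, rfl⟩ := exists_lift_of_isLimit_over hS t x e
      refine ⟨k ≫ g.left, fun T'' t' y' => ?_⟩
      rw [← Category.assoc, hG']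
      simp only [prod.lift_fst, prod.lift_snd]
      constructor
      · rintro ⟨l, l₁, l₂, l₃⟩
        have : l = t' ≫ k := hom_ext_of_isLimit_over hS (by simpa using l₁) (by simpa using l₂)
        rw [← l₃, this, Category.assoc]
      · intro h
        exact ⟨t' ≫ k, by simp, by simp, by simpa using h⟩
    · rintro ⟨y, hy⟩
      have := (hy (𝟙 _) y).2 (Category.id_comp _)
      rw [Category.id_comp, hG'] at this
      obtain ⟨k, rfl, k₂, -⟩ := this
      simp only [Category.id_comp, prod.lift_fst] at k₂
      rw [← k₂, Category.assoc, Category.assoc, Over.w, Over.w]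
    · rw [hG'] at hm
      obtain ⟨k, rfl, k₂, k₃⟩ := hm
      rw [← reassoc_of% k₂, ← reassoc_of% k₃, Category.assoc, Over.w, Over.w, Over.w]
      exact ⟨rfl, rfl⟩
  obtain ⟨z, hz₁, hz₂⟩ := huniv _ _ hfun
  have hcond : (f.left ≫ z) ≫ a = s.left ≫ X.hom := by
    rw [Category.assoc, hz₁, Over.w, Over.w]
  refine ⟨Over.homMk z hz₁, ⟨Over.homMk (pullback.lift (f.left ≫ z) s.left hcond) ?_, ?_, ?_, ?_⟩,
    ?_⟩
  · simp [hz₁]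
  · ext
    simp
  · ext
    simp
  · ext
    apply (hev _ _).1
    simp only [Over.homMk_left, pullback.lift_fst_assoc, pullback.lift_snd, Category.assoc, hz₂]
    rw [hG']
    exact ⟨𝟙 _, by simp, by simp, by simp⟩
  · rintro h ⟨k, k₁, k₂, k₃⟩
    have e₁ : k.left ≫ pullback.fst a X.hom = f.left ≫ h.left := congrArg CommaMorphism.left k₁
    have e₂ : k.left ≫ pullback.snd a X.hom = s.left := congrArg CommaMorphism.left k₂
    have e₃ : k.left ≫ ev = g.left := congrArg CommaMorphism.left k₃
    have e₀ : h.left ≫ a = T.hom := Over.w h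
    apply Over.OverMorphism.ext
    refine hext _ _ (e₀.trans hz₁.symm) (hQ.ext fun T' t w => ?_)
    have hw : prod.lift (w ≫ prod.fst) (w ≫ prod.snd) = w := by
      apply prod.hom_ext <;> simp
    -- At a point `l` of `S`, the graph named by `h` has the value that `ev` computes, namely that
    -- of `g`. By `hom_eq`, every element of that graph lies over such a point.
    have key : ∀ l : T' ⟶ S.left, l ≫ f.left = t → l ≫ s.left = w ≫ prod.fst →
        (mem (t ≫ h.left ≫ G) w ↔ l ≫ g.left = w ≫ prod.snd) := by
      intro l l₁ l₂
      have := hev (l ≫ k.left) (w ≫ prod.snd)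
      rw [Category.assoc, Category.assoc, reassoc_of% e₁, reassoc_of% l₁, e₂, l₂, hw,
        Category.assoc, e₃] at this
      exact this
    change _ ↔ mem (t ≫ z ≫ G) w
    rw [hz₂, hG']
    constructor
    · intro hm
      have := (hG.hom_eq (t ≫ h.left) w (by simpa using hm)).1
      obtain ⟨l, l₁, l₂⟩ := exists_lift_of_isLimit_over hS t (w ≫ prod.fst)
        (by rw [Category.assoc, this, Category.assoc, e₀])
      exact ⟨l, l₁, l₂, (key l l₁ l₂).1 hm⟩
    · rintro ⟨l, l₁, l₂, l₃⟩
      exact (key l l₁ l₂).2 l₃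

end OverExponential

/-! ### Subobject classifiers and exponentials -/

section Characterizations

variable {C : Type u₁} [Category.{v₁} C]

lemma isLimit_binaryFan_of_exists {X Y S : C} {f : S ⟶ X} {g : S ⟶ Y}
    (H : ∀ ⦃W : C⦄ (a : W ⟶ X) (b : W ⟶ Y), ∃ l : W ⟶ S, l ≫ f = a ∧ l ≫ g = b)
    (hext : ∀ ⦃W : C⦄ (l l' : W ⟶ S), l ≫ f = l' ≫ f → l ≫ g = l' ≫ g → l = l') :
    Nonempty (IsLimit (BinaryFan.mk f g)) := by
  choose k hk₁ hk₂ using H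
  exact ⟨BinaryFan.isLimitMk (fun c => k c.fst c.snd) (fun c => hk₁ _ _) (fun c => hk₂ _ _)
    fun c m e e' => hext _ _ (e.trans (hk₁ _ _).symm) (e'.trans (hk₂ _ _).symm)⟩

lemma exists_lift_of_isLimit_binaryFan {X Y S : C} {f : S ⟶ X} {g : S ⟶ Y}
    (h : IsLimit (BinaryFan.mk f g)) {W : C} (a : W ⟶ X) (b : W ⟶ Y) :
    ∃ l : W ⟶ S, l ≫ f = a ∧ l ≫ g = b :=
  ⟨h.lift (BinaryFan.mk a b), h.fac _ ⟨.left⟩, h.fac _ ⟨.right⟩⟩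

lemma isPullback_of_existsUnique {X₁ X₂ X₃ X₄ : C} {f : X₁ ⟶ X₂} {g : X₁ ⟶ X₃} {h : X₂ ⟶ X₄}
    {i : X₃ ⟶ X₄} (w : f ≫ h = g ≫ i) (H : ∀ ⦃W : C⦄ (a : W ⟶ X₂) (b : W ⟶ X₃), a ≫ h = b ≫ i →
      ∃ l : W ⟶ X₁, l ≫ f = a ∧ l ≫ g = b ∧ ∀ l' : W ⟶ X₁, l' ≫ f = a → l' ≫ g = b → l' = l) :
    IsPullback f g h i := by
  choose l h₁ h₂ h₃ using H
  exact ⟨⟨w⟩, ⟨PullbackCone.IsLimit.mk w (fun s => l s.fst s.snd s.condition)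
    (fun s => h₁ _ _ _) (fun s => h₂ _ _ _) fun s => h₃ _ _ _⟩⟩

/-- Leaving the map to `T` existentially quantified gives a form that transposes along an
adjunction. -/
lemma isSubobjectClassifier_iff {T Ω : C} (t : T ⟶ Ω) :
    IsSubobjectClassifier t ↔ Nonempty (IsTerminal T) ∧
      ∀ ⦃U V : C⦄ (m : U ⟶ V) [Mono m], ∃! χ : V ⟶ Ω, ∃ u : U ⟶ T, IsPullback m u χ t := by
  constructor
  · rintro ⟨c, ⟨e⟩⟩
    let e₁ : c.Ω₀ ≅ T := Arrow.leftFunc.mapIso e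
    let e₂ : c.Ω ≅ Ω := Arrow.rightFunc.mapIso e
    have w : e₁.hom ≫ t = c.truth ≫ e₂.hom := e.hom.w
    refine ⟨⟨c.isTerminalΩ₀.ofIso e₁⟩, fun U V m _ => ⟨c.χ m ≫ e₂.hom, ⟨c.χ₀ U ≫ e₁.hom, ?_⟩, ?_⟩⟩
    · exact (c.isPullback m).of_iso (Iso.refl _) (Iso.refl _) e₁ e₂ (by simp) (by simp) (by simp)
        w.symm
    · rintro χ ⟨u, h⟩
      rw [← c.uniq m (χ₀' := u ≫ e₁.inv) (χ' := χ ≫ e₂.inv), Category.assoc, Iso.inv_hom_id,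
        Category.comp_id]
      refine h.of_iso (Iso.refl _) (Iso.refl _) e₁.symm e₂.symm (by simp) (by simp) (by simp) ?_
      simp only [Iso.symm_hom]
      rw [Iso.comp_inv_eq, Category.assoc, ← w, Iso.inv_hom_id_assoc]
  · rintro ⟨⟨hT⟩, h⟩
    refine ⟨Subobject.Classifier.mkOfTerminalΩ₀ T hT Ω t (fun m _ => (h m).choose) ?_ ?_,
      ⟨Iso.refl _⟩⟩
    · intro U V m _
      obtain ⟨u, hu⟩ := (h m).choose_spec.1
      rwa [hT.hom_ext u (hT.from U)] at hu
    · intro U V m _ χ hχ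
      exact (h m).choose_spec.2 χ ⟨_, hχ⟩

end Characterizations

/-! ### Right adjoints of discrete fibrations are logical -/

section DiscreteFibration

variable {C : Type u₁} [Category.{v₁} C] {D : Type u₂} [Category.{v₂} D]

/-- The functor `L` is, up to isomorphism, a discrete fibration. -/
structure IsDiscreteFibration (L : D ⥤ C) : Prop where
  faithful : L.Faithful
  exists_lift_obj : ∀ ⦃V : D⦄ ⦃W : C⦄ (w : W ⟶ L.obj V),
    ∃ (W' : D) (w' : W' ⟶ V) (e : W ≅ L.obj W'), e.hom ≫ L.map w' = w
  exists_lift_hom : ∀ ⦃U V W : D⦄ (v : W ⟶ V) (m : U ⟶ V) (k : L.obj W ⟶ L.obj U),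
    k ≫ L.map m = L.map v → ∃ k' : W ⟶ U, L.map k' = k ∧ k' ≫ m = v

namespace IsDiscreteFibration

variable {L : D ⥤ C} {R : C ⥤ D}

/-- Two maps equalized by `L.map m` share a source over `L.obj V`. It lifts to `D`, both maps lift
with it, and `m` cancels there. -/
lemma mono_map (hL : IsDiscreteFibration L) {U V : D} (m : U ⟶ V) [Mono m] : Mono (L.map m) := by
  refine ⟨fun {W} k k' e => ?_⟩
  obtain ⟨W', w, i, hw⟩ := hL.exists_lift_obj (k ≫ L.map m)
  obtain ⟨l, hl, hlm⟩ := hL.exists_lift_hom w m (i.inv ≫ k) (by simp [← hw])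
  obtain ⟨l', hl', hlm'⟩ := hL.exists_lift_hom w m (i.inv ≫ k') (by simp [← hw, ← e])
  have : l = l' := by rw [← cancel_mono m, hlm, hlm']
  rw [← cancel_epi i.inv, ← hl, ← hl', this]

/-- Commuting squares correspond by transposition, and cones over `L.obj V` lift to cones over `V`.
Terminality of `T` makes the second leg irrelevant on both sides. -/
lemma isPullback_map_iff (hL : IsDiscreteFibration L) (adj : L ⊣ R) {T Ω : C} (t : T ⟶ Ω)
    (hT : IsTerminal T) {U V : D} (m : U ⟶ V) (χ : L.obj V ⟶ Ω) :
    (∃ u, IsPullback m u (adj.homEquiv _ _ χ) (R.map t)) ↔ ∃ u, IsPullback (L.map m) u χ t := by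
  have := hL.faithful
  have hadj : ∀ ⦃W : D⦄ (w : W ⟶ V) (u : L.obj W ⟶ T), w ≫ adj.homEquiv _ _ χ =
      adj.homEquiv _ _ u ≫ R.map t ↔ L.map w ≫ χ = u ≫ t := by
    intro W w u
    rw [← adj.homEquiv_naturality_left, ← adj.homEquiv_naturality_right,
      (adj.homEquiv _ _).apply_eq_iff_eq]
  constructor
  · rintro ⟨u, hu⟩
    have hu' : L.map m ≫ χ = (adj.homEquiv _ _).symm u ≫ t := by
      rw [← hadj, Equiv.apply_symm_apply, hu.w]
    refine ⟨_, isPullback_of_existsUnique hu' fun W' a b hab => ?_⟩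
    obtain ⟨W, w, i, hw⟩ := hL.exists_lift_obj a
    have hs : L.map w ≫ χ = (i.inv ≫ b) ≫ t := by
      rw [← cancel_epi i.hom, reassoc_of% hw, hab]
      simp
    refine ⟨i.hom ≫ L.map (hu.lift w _ ((hadj _ _).2 hs)), ?_, hT.hom_ext _ _, ?_⟩
    · rw [Category.assoc, ← L.map_comp, hu.lift_fst, hw]
    · intro k hk _
      obtain ⟨l, hl, hlm⟩ := hL.exists_lift_hom w m (i.inv ≫ k) (by simp [hk, ← hw])
      have : l = hu.lift w _ ((hadj _ _).2 hs) := by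
        apply hu.hom_ext
        · rw [hlm, hu.lift_fst]
        · exact (adj.homEquiv _ _).symm.injective (hT.hom_ext _ _)
      rw [← this, hl, Iso.hom_inv_id_assoc]
  · rintro ⟨u, hu⟩
    refine ⟨adj.homEquiv _ _ u, isPullback_of_existsUnique ((hadj _ _).2 hu.w) fun W a b hab => ?_⟩
    have hs : L.map a ≫ χ = (adj.homEquiv _ _).symm b ≫ t := by
      rw [← hadj, Equiv.apply_symm_apply, hab]
    obtain ⟨l, hl, hlm⟩ := hL.exists_lift_hom a m (hu.lift _ _ hs) (hu.lift_fst _ _ _)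
    refine ⟨l, hlm, (adj.homEquiv _ _).symm.injective (hT.hom_ext _ _), ?_⟩
    intro k hk _
    apply L.map_injective
    apply hu.hom_ext _ (hT.hom_ext _ _)
    rw [hl, hu.lift_fst, ← L.map_comp, hk]

lemma isSubobjectClassifier_map (hL : IsDiscreteFibration L) (adj : L ⊣ R) {T Ω : C} (t : T ⟶ Ω)
    (h : IsSubobjectClassifier t) : IsSubobjectClassifier (R.map t) := by
  rw [isSubobjectClassifier_iff] at h ⊢
  obtain ⟨⟨hT⟩, h⟩ := h
  refine ⟨⟨IsTerminal.ofUniqueHom (fun X => adj.homEquiv _ _ (hT.from _)) fun X k =>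
    (adj.homEquiv _ _).symm.injective (hT.hom_ext _ _)⟩, fun U V m _ => ?_⟩
  have := hL.mono_map m
  obtain ⟨χ, hχ, hu⟩ := h (L.map m)
  refine ⟨adj.homEquiv _ _ χ, (hL.isPullback_map_iff adj t hT m χ).2 hχ, fun χ' hχ' => ?_⟩
  obtain ⟨χ', rfl⟩ := (adj.homEquiv _ _).surjective χ'
  rw [hu χ' ((hL.isPullback_map_iff adj t hT m χ').1 hχ')]

/-- Frobenius reciprocity: `L (Y × R X) ≅ L Y × X`. -/
lemma isLimit_binaryFan_map (hL : IsDiscreteFibration L) (adj : L ⊣ R) {X : C} {S Y : D}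
    {f : S ⟶ Y} {s : S ⟶ R.obj X} (h : IsLimit (BinaryFan.mk f s)) :
    Nonempty (IsLimit (BinaryFan.mk (L.map f) ((adj.homEquiv _ _).symm s))) := by
  have := hL.faithful
  refine isLimit_binaryFan_of_exists (fun W a b => ?_) (fun W k k' e e' => ?_)
  · obtain ⟨W', w, i, hw⟩ := hL.exists_lift_obj a
    obtain ⟨k, hk₁, hk₂⟩ := exists_lift_of_isLimit_binaryFan h w (adj.homEquiv _ _ (i.inv ≫ b))
    refine ⟨i.hom ≫ L.map k, ?_, ?_⟩
    · rw [Category.assoc, ← L.map_comp, hk₁, hw]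
    · rw [Category.assoc, ← adj.homEquiv_naturality_left_symm, hk₂, Equiv.symm_apply_apply,
        Iso.hom_inv_id_assoc]
  · obtain ⟨W', w, i, hw⟩ := hL.exists_lift_obj (k ≫ L.map f)
    obtain ⟨l, hl, hlm⟩ := hL.exists_lift_hom w f (i.inv ≫ k) (by simp [← hw])
    obtain ⟨l', hl', hlm'⟩ := hL.exists_lift_hom w f (i.inv ≫ k') (by simp [← hw, ← e])
    have : l = l' := by
      apply BinaryFan.IsLimit.hom_ext h
      · exact hlm.trans hlm'.symm
      · apply (adj.homEquiv _ _).symm.injective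
        change (adj.homEquiv _ _).symm (l ≫ s) = (adj.homEquiv _ _).symm (l' ≫ s)
        rw [adj.homEquiv_naturality_left_symm, adj.homEquiv_naturality_left_symm, hl, hl',
          Category.assoc, Category.assoc, e']
    rw [← cancel_epi i.inv, ← hl, ← hl', this]

/-- By adjunction and Frobenius, maps `Y × R A ⟶ R B` correspond to maps `L Y × A ⟶ B`, hence to `L
Y ⟶ X`, hence to `Y ⟶ R X`. -/
lemma isExponential_map (hL : IsDiscreteFibration L) (adj : L ⊣ R) {A B X S : C} {fst : S ⟶ X}
    {snd : S ⟶ A} {ev : S ⟶ B} (h : IsExponential fst snd ev) :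
    IsExponential (R.map fst) (R.map snd) (R.map ev) := by
  have := adj.rightAdjoint_preservesLimits
  obtain ⟨⟨hS⟩, h⟩ := h
  refine ⟨⟨mapIsLimitOfPreservesOfIsLimit R fst snd hS⟩, fun Y P f s ⟨hP⟩ g => ?_⟩
  obtain ⟨c, hc, hu⟩ := h _ _ (hL.isLimit_binaryFan_map adj hP) ((adj.homEquiv _ _).symm g)
  have key : ∀ c : L.obj Y ⟶ X,
      (∃ k : P ⟶ R.obj S, k ≫ R.map fst = f ≫ adj.homEquiv _ _ c ∧ k ≫ R.map snd = s ∧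
        k ≫ R.map ev = g) ↔
      ∃ k : L.obj P ⟶ S, k ≫ fst = L.map f ≫ c ∧ k ≫ snd = (adj.homEquiv _ _).symm s ∧
        k ≫ ev = (adj.homEquiv _ _).symm g := by
    intro c
    rw [(adj.homEquiv P S).symm.exists_congr_left]
    refine exists_congr fun k => ?_
    rw [Equiv.symm_symm, ← adj.homEquiv_naturality_right, ← adj.homEquiv_naturality_right,
      ← adj.homEquiv_naturality_right, ← adj.homEquiv_naturality_left,
      (adj.homEquiv _ _).apply_eq_iff_eq, Equiv.eq_symm_apply, Equiv.eq_symm_apply]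
  refine ⟨adj.homEquiv _ _ c, (key c).2 hc, fun c' hc' => ?_⟩
  obtain ⟨c', rfl⟩ := (adj.homEquiv _ _).surjective c'
  exact congrArg _ (hu c' ((key c').1 hc'))

/-- The right adjoint of a discrete fibration is logical. -/
theorem isLogicalFunctor (hL : IsDiscreteFibration L) (adj : L ⊣ R) : IsLogicalFunctor R where
  preservesFiniteLimits :=
    have := adj.rightAdjoint_preservesLimits
    inferInstance
  map_isExponential _ _ _ _ _ _ _ h := hL.isExponential_map adj h
  map_isSubobjectClassifier _ _ t h := hL.isSubobjectClassifier_map adj t h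

end IsDiscreteFibration

lemma isDiscreteFibration_forget (A : C) : IsDiscreteFibration (Over.forget A) where
  faithful := inferInstance
  exists_lift_obj V W w := ⟨Over.mk (w ≫ V.hom), Over.homMk w, Iso.refl _, Category.id_comp _⟩
  exists_lift_hom U V W v m k hk := by
    replace hk : k ≫ m.left = v.left := hk
    refine ⟨Over.homMk k ?_, rfl, Over.OverMorphism.ext hk⟩
    rw [← Over.w m]
    exact (Category.assoc _ _ _).symm.trans ((hk =≫ V.hom).trans (Over.w v))

lemma isDiscreteFibration_map {A B : C} (f : A ⟶ B) : IsDiscreteFibration (Over.map f) where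
  faithful := ⟨fun {_ _ a b} h => Over.OverMorphism.ext
    (congrArg CommaMorphism.left h : ((Over.map f).map a).left = ((Over.map f).map b).left)⟩
  exists_lift_obj V W w := ⟨Over.mk (w.left ≫ V.hom), Over.homMk w.left,
    Over.isoMk (Iso.refl _) (by
      have := Over.w w
      simp at this
      simp [this]), by ext; simp⟩
  exists_lift_hom U V W v m k hk := by
    replace hk : k.left ≫ m.left = v.left := congrArg CommaMorphism.left hk
    refine ⟨Over.homMk k.left ?_, rfl, Over.OverMorphism.ext hk⟩
    rw [← Over.w m, reassoc_of% hk, Over.w]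

end DiscreteFibration

/-! ### Exponentials and cartesian closedness -/

section Exponentials

variable {C : Type u₁} [Category.{v₁} C]

lemma IsExponential.nonempty_iso {A B X R X' R' : C} {fst : R ⟶ X} {snd : R ⟶ A} {ev : R ⟶ B}
    {fst' : R' ⟶ X'} {snd' : R' ⟶ A} {ev' : R' ⟶ B} (h : IsExponential fst snd ev)
    (h' : IsExponential fst' snd' ev') : Nonempty (X ≅ X') := by
  obtain ⟨f, ⟨k, k₁, k₂, k₃⟩, -⟩ := h'.existsUnique_curry fst snd h.isProduct ev
  obtain ⟨f', ⟨k', k₁', k₂', k₃'⟩, -⟩ := h.existsUnique_curry fst' snd' h'.isProduct ev'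
  refine ⟨⟨f, f', ?_, ?_⟩⟩
  · exact (h.existsUnique_curry fst snd h.isProduct ev).unique
      ⟨k ≫ k', by rw [Category.assoc, k₁', reassoc_of% k₁], by rw [Category.assoc, k₂', k₂],
        by rw [Category.assoc, k₃', k₃]⟩ ⟨𝟙 _, by simp, by simp, by simp⟩
  · exact (h'.existsUnique_curry fst' snd' h'.isProduct ev').unique
      ⟨k' ≫ k, by rw [Category.assoc, k₁, reassoc_of% k₁'], by rw [Category.assoc, k₂, k₂'],
        by rw [Category.assoc, k₃, k₃']⟩ ⟨𝟙 _, by simp, by simp, by simp⟩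

lemma IsExponential.comp_iso {A B X R A' B' : C} {fst : R ⟶ X} {snd : R ⟶ A} {ev : R ⟶ B}
    (h : IsExponential fst snd ev) (e : A ≅ A') (i : B ≅ B') :
    IsExponential fst (snd ≫ e.hom) (ev ≫ i.hom) := by
  have hprod : ∀ {A A' X R : C} {fst : R ⟶ X} {snd : R ⟶ A} (e : A ≅ A'),
      IsLimit (BinaryFan.mk fst snd) → Nonempty (IsLimit (BinaryFan.mk fst (snd ≫ e.hom))) := by
    intro A A' X R fst snd e h
    exact isLimit_binaryFan_of_exists (f := fst) (g := snd ≫ e.hom) (fun W a b => by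
      obtain ⟨l, h₁, h₂⟩ := exists_lift_of_isLimit_binaryFan h a (b ≫ e.inv)
      exact ⟨l, h₁, by simp [reassoc_of% h₂]⟩) fun W l l' h₁ h₂ =>
        BinaryFan.IsLimit.hom_ext h h₁ ((cancel_mono e.hom).1
          ((Category.assoc _ _ _).trans (h₂.trans (Category.assoc _ _ _).symm)))
  obtain ⟨⟨hR⟩, hc⟩ := h
  refine ⟨hprod e hR, fun Y S f s ⟨hS⟩ g => ?_⟩
  simpa only [← Category.assoc, Iso.eq_comp_inv, Iso.comp_hom_eq_id] using
    hc f (s ≫ e.inv) (hprod e.symm hS) (g ≫ i.inv)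

-- The projections are swapped because `ihom A` is adjoint to tensoring with `A` on the left, while
-- `IsExponential` lists `A` second.
open CartesianMonoidalCategory MonoidalCategory in
lemma isLimit_mk_snd_fst [CartesianMonoidalCategory C] (A Y : C) :
    Nonempty (IsLimit (BinaryFan.mk (snd A Y) (fst A Y))) :=
  isLimit_binaryFan_of_exists (fun _ a b => ⟨lift b a, lift_snd _ _, lift_fst _ _⟩)
    fun _ _ _ h h' => CartesianMonoidalCategory.hom_ext _ _ h' h

open CartesianMonoidalCategory MonoidalCategory in
lemma exists_isExponential_of_monoidalClosed [CartesianMonoidalCategory C] [MonoidalClosed C]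
    (A B : C) : ∃ (X R : C) (fst : R ⟶ X) (snd : R ⟶ A) (ev : R ⟶ B), IsExponential fst snd ev := by
  refine ⟨(ihom A).obj B, A ⊗ (ihom A).obj B, snd _ _, fst _ _, (ihom.ev A).app B,
    ⟨isLimit_mk_snd_fst _ _, ?_⟩⟩
  · intro Y S f s ⟨hS⟩ g
    let j : A ⊗ Y ⟶ S := hS.lift (BinaryFan.mk (snd _ _) (fst _ _))
    have j₁ : j ≫ f = snd _ _ := hS.fac _ ⟨.left⟩
    have j₂ : j ≫ s = fst _ _ := hS.fac _ ⟨.right⟩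
    have e₁ : lift s f ≫ j = 𝟙 S := by
      apply BinaryFan.IsLimit.hom_ext hS
      · simp [j₁]
      · simp [j₂]
    have e₂ : j ≫ lift s f = 𝟙 _ := by
      ext <;> simp [j₁, j₂]
    have key : ∀ h : Y ⟶ (ihom A).obj B, (∃ k : S ⟶ A ⊗ (ihom A).obj B, k ≫ snd _ _ = f ≫ h ∧
        k ≫ fst _ _ = s ∧ k ≫ (ihom.ev A).app B = g) ↔ h = MonoidalClosed.curry (j ≫ g) := by
      intro h
      rw [MonoidalClosed.eq_curry_iff, MonoidalClosed.uncurry_eq]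
      constructor
      · rintro ⟨k, k₁, k₂, rfl⟩
        rw [← Category.assoc j]
        congr 1
        ext
        · simp [k₂, j₂]
        · simp [k₁, reassoc_of% j₁]
      · intro e
        refine ⟨lift s f ≫ A ◁ h, by simp, by simp, ?_⟩
        rw [Category.assoc, e, reassoc_of% e₁]
    simp only [key]
    exact existsUnique_eq

-- An exponential of `B` by `A` is a terminal object of the comma category of `A ⊗ -` over `B`;
-- having one for every `B` gives the right adjoint.
open CartesianMonoidalCategory MonoidalCategory in
lemma exists_monoidalClosed_of_isExponential [HasFiniteProducts C]
    (h : ∀ A B : C, ∃ (X R : C) (fst : R ⟶ X) (snd : R ⟶ A) (ev : R ⟶ B),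
      IsExponential fst snd ev) :
    ∃ _ : CartesianMonoidalCategory C, Nonempty (MonoidalClosed C) := by
  let _ : CartesianMonoidalCategory C := .ofHasFiniteProducts
  refine ⟨inferInstance, ?_⟩
  have (A : C) : (tensorLeft A).IsLeftAdjoint := by
    have (B : C) : HasTerminal (CostructuredArrow (tensorLeft A) B) := by
      obtain ⟨X, R, p, q, ev, ⟨⟨hR⟩, hc⟩⟩ := h A B
      let i : A ⊗ X ⟶ R := hR.lift (BinaryFan.mk (snd _ _) (fst _ _))
      have i₁ : i ≫ p = snd _ _ := hR.fac _ ⟨.left⟩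
      have i₂ : i ≫ q = fst _ _ := hR.fac _ ⟨.right⟩
      have key : ∀ (Y : C) (g : A ⊗ Y ⟶ B), ∃! h : Y ⟶ X, A ◁ h ≫ i ≫ ev = g := by
        intro Y g
        have key : ∀ h : Y ⟶ X, (∃ k, k ≫ p = snd A Y ≫ h ∧ k ≫ q = fst A Y ∧ k ≫ ev = g) ↔
            A ◁ h ≫ i ≫ ev = g := by
          intro h
          constructor
          · rintro ⟨k, k₁, k₂, rfl⟩
            rw [← Category.assoc]
            congr 1
            apply BinaryFan.IsLimit.hom_ext hR
            · simp [i₁, k₁]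
            · simp [i₂, k₂]
          · intro e
            exact ⟨A ◁ h ≫ i, by simp [i₁], by simp [i₂], by simpa using e⟩
        simpa only [key] using hc (snd A Y) (fst A Y) (isLimit_mk_snd_fst A Y) g
      choose l hl hu using key
      exact (IsTerminal.ofUniqueHom (Y := CostructuredArrow.mk (Y := X)
          (S := tensorLeft A) (i ≫ ev))
        (fun Z => CostructuredArrow.homMk (l Z.left Z.hom) (hl _ _))
        fun Z m => CostructuredArrow.hom_ext _ _ (hu _ _ _ (CostructuredArrow.w m))).hasTerminal
    exact isLeftAdjoint_of_costructuredArrowTerminals _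
  exact ⟨⟨fun A => ⟨_, Adjunction.ofIsLeftAdjoint (tensorLeft A)⟩⟩⟩

end Exponentials

/-! ### The fundamental theorem of topos theory -/

section Fundamental

variable {C : Type u₁} [Category.{v₁} C]

lemma IsTopos.exists_isExponential [h : IsTopos C] (A B : C) :
    ∃ (X R : C) (fst : R ⟶ X) (snd : R ⟶ A) (ev : R ⟶ B), IsExponential fst snd ev := by
  obtain ⟨_, ⟨_⟩⟩ := h.cartesianClosed
  exact exists_isExponential_of_monoidalClosed A B

/-- Every slice of a topos is a topos. -/
theorem isTopos_over [IsTopos C] (A : C) : IsTopos (Over A) where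
  exists_classifier := by
    obtain ⟨c⟩ := HasSubobjectClassifier.exists_classifier (C := C)
    obtain ⟨c', -⟩ := (isDiscreteFibration_forget A).isSubobjectClassifier_map
      (Over.forgetAdjStar A) c.truth ⟨c, ⟨Iso.refl _⟩⟩
    exact ⟨c'⟩
  out := (inferInstance : HasFiniteLimits (Over A)).out
  cartesianClosed := by
    refine exists_monoidalClosed_of_isExponential fun X Y => ?_
    obtain ⟨c⟩ := HasSubobjectClassifier.exists_classifier (C := C)
    obtain ⟨Z, R, fst, snd, ev, h, -⟩ := exists_isExponential_over ⊤ (fun Y _ => by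
      obtain ⟨Q, R, fst, snd, ev, h⟩ := IsTopos.exists_isExponential Y c.Ω
      obtain ⟨mem, hmem⟩ := h.exists_isPowerObject c
      exact ⟨Q, mem, hmem, trivial⟩) X Y trivial trivial trivial
    exact ⟨Z, R, fst, snd, ev, h⟩

lemma isLogicalFunctor_pullback [HasPullbacks C] {A B : C} (f : A ⟶ B) :
    IsLogicalFunctor (Over.pullback f) :=
  (isDiscreteFibration_map f).isLogicalFunctor (Over.mapPullbackAdj f)

end Fundamental

/-! ### Logical subtoposes -/

section Subtopos

variable {C : Type u₁} [Category.{v₁} C] {P : ObjectProperty C}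

/-- `P` contains some limit of each finite diagram, not every one, hence the passage to
`isoClosure`. A diagram there is first replaced by an isomorphic one with values in `P`. -/
lemma IsLogicalSubtopos.isClosedUnderLimitsOfShape (hP : IsLogicalSubtopos P) (J : Type)
    [SmallCategory J] [FinCategory J] : P.isoClosure.IsClosedUnderLimitsOfShape J where
  limitsOfShape_le := by
    rintro X ⟨h⟩
    choose obj hobj e using fun j => h.prop_diag_obj j
    let K := h.diag.copyObj obj (fun j => (e j).some)
    obtain ⟨c, ⟨hc⟩, hcP⟩ := hP.finiteLimits J K hobj
    exact ⟨c.pt, hcP, ⟨h.isLimit.conePointsIsoOfNatIso hc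
      (h.diag.isoCopyObj obj fun j => (e j).some)⟩⟩

/-- The exponential of the classifier of `P` by a representative of `Y` in `P`, transported along
isomorphisms, is a power object of `Y`. -/
lemma IsLogicalSubtopos.exists_isPowerObject [HasFiniteLimits C] (hP : IsLogicalSubtopos P)
    (Y : C) (hY : P.isoClosure Y) : ∃ Q mem, IsPowerObject Y Q mem ∧ P.isoClosure Q := by
  obtain ⟨Y', hY', ⟨e⟩⟩ := hY
  obtain ⟨T, Ω, t, ⟨c, ⟨i⟩⟩, -, hΩ⟩ := hP.subobjectClassifier
  obtain ⟨Q, R, fst, snd, ev, h, hQ⟩ := hP.exponentials Y' Ω hY' hΩ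
  obtain ⟨mem, hmem⟩ := (h.comp_iso e.symm (Arrow.rightFunc.mapIso i).symm).exists_isPowerObject c
  exact ⟨Q, mem, hmem, P.le_isoClosure _ hQ⟩

end Subtopos

/-! ### Locally small maps -/

section LocallySmall

variable {C : Type u} [Category.{v} C] {E : ObjectProperty C}

lemma locallySmall_of_isPullback [HasPullbacks C] {X Y X' Y' : C} {g : X' ⟶ X} {q : X' ⟶ Y'}
    {p : X ⟶ Y} {f : Y' ⟶ Y} (h : IsPullback g q p f) (hp : locallySmall E p) :
    locallySmall E q := by
  intro A a hA
  obtain ⟨D, u, r, hD, hE⟩ := hp (a ≫ f) hA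
  have w : u ≫ p = (r ≫ a) ≫ f := by rw [hD.w, Category.assoc]
  refine ⟨D, h.lift u (r ≫ a) w, r, ?_, hE⟩
  refine IsPullback.of_right (h₁₂ := g) (h₂₂ := f) ?_ (h.lift_snd _ _ _) h
  rwa [h.lift_fst]

/-- Pulling `g` back along `a` yields a vertex in `E`, so `f` may in turn be pulled back along the
map `u` from that vertex. -/
lemma locallySmall_comp {X Y Z : C} {f : X ⟶ Y} {g : Y ⟶ Z} (hf : locallySmall E f)
    (hg : locallySmall E g) : locallySmall E (f ≫ g) := by
  intro A a hA
  obtain ⟨D, u, q, hD, hE⟩ := hg a hA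
  obtain ⟨D', u', q', hD', hE'⟩ := hf u hE
  exact ⟨D', u', q' ≫ q, hD'.paste_vert hD, hE'⟩

lemma isDisplayClass_locallySmall [HasPullbacks C] : IsDisplayClass (locallySmall E) where
  respectsIso :=
    have : (locallySmall E).IsStableUnderBaseChange :=
      ⟨fun h hp => locallySmall_of_isPullback h hp⟩
    inferInstance
  exists_isPullback _ _ _ p f hp :=
    ⟨_, _, _, IsPullback.of_hasPullback p f,
      locallySmall_of_isPullback (IsPullback.of_hasPullback p f) hp⟩

lemma displayOver_locallySmall_iff [HasPullbacks C] {I : C} (X : Over I) :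
    displayOver (locallySmall E) I X ↔
      ∀ ⦃A : C⦄ (f : A ⟶ I), E A → E.isoClosure ((Over.pullback f).obj X).left := by
  constructor
  · intro h A f hA
    obtain ⟨D, g, q, hD, hE⟩ := h f hA
    exact ⟨D, hE, ⟨hD.isoPullback.symm⟩⟩
  · intro h A f hA
    obtain ⟨D, hD, ⟨e⟩⟩ := h f hA
    exact ⟨D, e.inv ≫ pullback.fst _ _, e.inv ≫ pullback.snd _ _,
      IsPullback.of_iso_pullback ⟨by simp [pullback.condition]⟩ e.symm rfl rfl, hD⟩

variable [IsTopos C]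

lemma displayOver_locallySmall_limits (hE : IsLogicalSubtopos E) (I : C) (J : Type)
    [SmallCategory J] [FinCategory J] (K : J ⥤ Over I)
    (hK : ∀ j, displayOver (locallySmall E) I (K.obj j)) :
    ∃ c : Cone K, Nonempty (IsLimit c) ∧ displayOver (locallySmall E) I c.pt := by
  let Q := displayOver (locallySmall E) I
  have : Q.IsClosedUnderLimitsOfShape WalkingCospan := ⟨by
    rintro X ⟨h⟩
    refine (displayOver_locallySmall_iff X).2 fun A f hA => ?_
    have := hE.isClosedUnderLimitsOfShape WalkingCospan
    -- Forgetting to `C` preserves pullbacks, but not the terminal object, which is therefore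
    -- treated separately: `f^*` of it has total object `A`.
    have hlim := isLimitOfPreserves (Over.pullback f ⋙ Over.forget A) h.isLimit
    have := E.isoClosure.prop_of_isLimit hlim fun j =>
      (displayOver_locallySmall_iff (h.diag.obj j)).1 (h.prop_diag_obj j) f hA
    exact this⟩
  have : Q.IsClosedUnderLimitsOfShape (Discrete PEmpty.{1}) := ⟨by
    rintro X ⟨h⟩
    refine (displayOver_locallySmall_iff X).2 fun A f hA => ?_
    have hX : IsTerminal X :=
      isLimitChangeEmptyCone _ h.isLimit (asEmptyCone X) (Iso.refl _)
    exact ⟨A, hA, ⟨(Over.forget A).mapIso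
      ((hX.isTerminalObj (Over.pullback f)).uniqueUpToIso Over.mkIdTerminal)⟩⟩⟩
  have := preservesFiniteLimits_of_preservesTerminal_and_pullbacks Q.ι
  have : HasFiniteLimits Q.FullSubcategory := hasFiniteLimits_of_hasTerminal_and_pullbacks
  exact ⟨Q.ι.mapCone (limit.cone (Q.lift K hK)),
    ⟨isLimitOfPreserves Q.ι (limit.isLimit (Q.lift K hK))⟩, (limit (Q.lift K hK)).property⟩

lemma displayOver_locallySmall_exponential (hE : IsLogicalSubtopos E) {I : C} {X Y Z R : Over I}
    (hX : displayOver (locallySmall E) I X) (hY : displayOver (locallySmall E) I Y)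
    {fst : R ⟶ Z} {snd : R ⟶ X} {ev : R ⟶ Y} (h : IsExponential fst snd ev) :
    displayOver (locallySmall E) I Z := by
  refine (displayOver_locallySmall_iff Z).2 fun A f hA => ?_
  have := hE.isClosedUnderLimitsOfShape (Discrete WalkingPair)
  have := hE.isClosedUnderLimitsOfShape WalkingParallelPair
  -- This exponential over `A` is built within `E.isoClosure`; `f^* Z` is another exponential of the
  -- same objects, hence isomorphic to it.
  obtain ⟨Z', R', fst', snd', ev', h', hZ'⟩ := exists_isExponential_over E.isoClosure
    hE.exists_isPowerObject ((Over.pullback f).obj X) ((Over.pullback f).obj Y)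
    (E.le_isoClosure _ hA) ((displayOver_locallySmall_iff X).1 hX f hA)
    ((displayOver_locallySmall_iff Y).1 hY f hA)
  obtain ⟨e⟩ := ((isLogicalFunctor_pullback f).map_isExponential _ _ _ h).nonempty_iso h'
  exact E.isoClosure.prop_of_iso ((Over.forget A).mapIso e).symm hZ'

/-- The pullback of the constant family `X` along `f` has total object `A ⨯ X`. -/
lemma displayOver_locallySmall_star (hE : IsLogicalSubtopos E) (I : C) {X : C} (hX : E X) :
    displayOver (locallySmall E) I ((Over.star I).obj X) := by
  refine (displayOver_locallySmall_iff _).2 fun A f hA => ?_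
  have := hE.isClosedUnderLimitsOfShape (Discrete WalkingPair)
  exact E.isoClosure.prop_of_iso
    ((Over.forget A).mapIso ((Over.starPullbackIsoStar f).app X)).symm
    (E.isoClosure.prop_prod A X (E.le_isoClosure _ hA) (E.le_isoClosure _ hX))

lemma isLogicalSubtopos_displayOver (hE : IsLogicalSubtopos E) (I : C) :
    IsLogicalSubtopos (displayOver (locallySmall E) I) where
  finiteLimits := displayOver_locallySmall_limits hE I
  exponentials X Y hX hY := by
    have := isTopos_over I
    obtain ⟨Z, R, fst, snd, ev, h⟩ := IsTopos.exists_isExponential X Y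
    exact ⟨Z, R, fst, snd, ev, h, displayOver_locallySmall_exponential hE hX hY h⟩
  subobjectClassifier := by
    obtain ⟨T, Ω, t, ht, hT, hΩ⟩ := hE.subobjectClassifier
    exact ⟨_, _, (Over.star I).map t,
      (isDiscreteFibration_forget I).isSubobjectClassifier_map (Over.forgetAdjStar I) t ht,
      displayOver_locallySmall_star hE I hT, displayOver_locallySmall_star hE I hΩ⟩

end LocallySmall

end StreicherUniverse

theorem mainTheorem4 {F : Type u} [Category.{v} F] [StreicherUniverse.IsTopos F]
    (E : ObjectProperty F) (hE : StreicherUniverse.IsDenseLogicalSubtopos E)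
    (hgen : ∃ (V U : F) (p : V ⟶ U),
      StreicherUniverse.IsGeneric (StreicherUniverse.locallySmall E) p) :
    StreicherUniverse.IsImpredicativeUniverse (StreicherUniverse.locallySmall E) where
  isDisplayClass := StreicherUniverse.isDisplayClass_locallySmall
  comp_mem _ _ _ _ _ := StreicherUniverse.locallySmall_comp
  exists_generic := hgen
  isIndexedLogicalSubtopos :=
    { isTopos := StreicherUniverse.isTopos_over
      isLogicalFunctor := fun _ _ => StreicherUniverse.isLogicalFunctor_pullback
      reindex := fun _ _ _ _ => StreicherUniverse.locallySmall_of_isPullback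
        (IsPullback.of_hasPullback _ _)
      isLogicalSubtopos := StreicherUniverse.isLogicalSubtopos_displayOver hE.toIsLogicalSubtopos }
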